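/- Let $a$ be an action of a $K$-armed bandit, let $\mathbb{T}_a$ be the (possibly random) set of time steps at which $a$ was chosen so far, and let $n_a=|\mathbb{T}_a|$ be a fixed number. Assume that the rewards yielded by the successive $n_a$ plays of $a$ are independent and identically distributed with values in $[0,1]$ (for example Bernoulli$(\mu_a)$), with variance $\sigma_a^2$, $\sigma_a\ge 0$. For $n\in\mathbb{T}_a$ let $\hat\mu_{n,a}$ be the average of the rewards $r_m$ over $m\in\mathbb{T}_a$, $m\le n$ (the reward $r_n$ included), and let $$\tau_a^2=\frac1{n_a}\sum_{n\in\mathbb{T}_a}\left(r_n-\hat\mu_{n,a}\right)^2$$ be the SAU statistic ($\tau_a^2=0$ if $n_a=0$). Then there is a universal constant $c>0$ (independent of the bandit, of the reward distribution and of $n_a$) such that $\tau_a^2$ is integrable and, for every $\delta\in\left[2\exp\left(-\sigma_a^2n_a/(32c)\right),1\right)$, $$\Pr\left\{\left|\tau_a^2-\mathbb{E}[\tau_a^2]\right|\ge\sigma_a\sqrt{\frac{8c\log(2/\delta)}{n_a}}\right\}\le\delta .$$ -/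

import Mathlib

open MeasureTheory ProbabilityTheory

namespace Bandit

/-- The set `𝕋_a` of the time steps before step `N` (steps are numbered from `0`) at which
action `a` was chosen, when `A n` is the action taken at step `n`. -/
def playTimes {K : ℕ} {Ω : Type*} (A : ℕ → Ω → Fin K) (N : ℕ) (a : Fin K) (ω : Ω) : Finset ℕ :=
  (Finset.range N).filter (fun n => A n ω = a)

/-- The sample average of the rewards obtained with action `a` up to and including step `n`. -/
noncomputable def valueEstimate {K : ℕ} {Ω : Type*} (A : ℕ → Ω → Fin K) (r : ℕ → Ω → ℝ)
    (a : Fin K) (n : ℕ) (ω : Ω) : ℝ :=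
  (∑ m ∈ playTimes A (n + 1) a ω, r m ω) / ((playTimes A (n + 1) a ω).card : ℝ)

/-- The SAU statistic `τ_a²`: the average over the plays of `a` (before the current step `N ω`)
of the squared prediction residuals. -/
noncomputable def sau {K : ℕ} {Ω : Type*} (A : ℕ → Ω → Fin K) (N : Ω → ℕ) (r : ℕ → Ω → ℝ)
    (a : Fin K) (ω : Ω) : ℝ :=
  (∑ n ∈ playTimes A (N ω) a ω, (r n ω - valueEstimate A r a n ω) ^ 2) /
    ((playTimes A (N ω) a ω).card : ℝ)

/-- The reward `r_{a,j}` yielded by the `j`-th play of action `a` (plays are numbered from `0`). -/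
noncomputable def playReward {K : ℕ} {Ω : Type*} (A : ℕ → Ω → Fin K) (r : ℕ → Ω → ℝ)
    (a : Fin K) (j : ℕ) (ω : Ω) : ℝ :=
  r (Nat.nth (fun n => A n ω = a) j) ω

end Bandit

namespace Bandit

/-! Reindexing by plays turns `sau` almost surely into `residualSum` of an i.i.d. sequence, divided
by its length, and centring the sequence changes nothing. Expanding the running means
(`residualSum_eq`) gives, up to a constant, the sum of a_i (y_i² − σ²) + b_i y_i S_i with S_i =
∑_{j<i} y_j. This is a martingale, as y_i is centred and independent of the past. Although |S_i| may
reach i, b_i is O(1/i), so |a_i| ≤ 1 and |b_i S_i| ≤ 2.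

Hence, for |θ| ≤ 1/3, each increment has conditional moment generating function at most exp(10 θ²
σ²) (`integral_exp_le`). These factors multiply (`lintegral_exp_quadForm_le`), and Chernoff's bound
with the optimal θ (`chernoff_exponent`) concludes; the lower bound on δ keeps θ admissible. -/

theorem exp_le_one_add_add_sq {x : ℝ} (hx : |x| ≤ 1) : Real.exp x ≤ 1 + x + x ^ 2 := by
  have := (abs_le.1 (Real.abs_exp_sub_one_sub_id_le hx)).2
  linarith

/-- The sum of the squared prediction residuals of a sequence. -/
noncomputable def residualSum (n : ℕ) (x : ℕ → ℝ) : ℝ :=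
  ∑ k ∈ Finset.range n, (x k - (∑ j ∈ Finset.range (k + 1), x j) / ((k : ℝ) + 1)) ^ 2

/-! ### Reindexing from time steps to plays. -/

theorem sum_filter_range_count (p : ℕ → Prop) [DecidablePred p] (g : ℕ → ℕ → ℝ) (N : ℕ) :
    ∑ m ∈ (Finset.range N).filter p, g m (Nat.count p m) =
      ∑ j ∈ Finset.range (Nat.count p N), g (Nat.nth p j) j := by
  induction N with
  | zero => simp
  | succ N ih =>
    rw [Finset.range_add_one, Finset.filter_insert, Nat.count_succ]
    split_ifs with h
    · rw [Finset.sum_insert (by simp), ih, Finset.sum_range_succ, Nat.nth_count h, add_comm]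
    · simpa using ih

theorem card_playTimes {K : ℕ} {Ω : Type*} (A : ℕ → Ω → Fin K) (N : ℕ) (a : Fin K) (ω : Ω) :
    (playTimes A N a ω).card = Nat.count (fun n => A n ω = a) N := by
  rw [Nat.count_eq_card_filter_range, playTimes]

theorem valueEstimate_eq {K : ℕ} {Ω : Type*} (A : ℕ → Ω → Fin K) (r : ℕ → Ω → ℝ)
    (a : Fin K) {n : ℕ} {ω : Ω} (hn : A n ω = a) :
    valueEstimate A r a n ω =
      (∑ j ∈ Finset.range (Nat.count (fun n => A n ω = a) n + 1), playReward A r a j ω) /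
        ((Nat.count (fun n => A n ω = a) n : ℝ) + 1) := by
  have hc : Nat.count (fun n => A n ω = a) (n + 1) = Nat.count (fun n => A n ω = a) n + 1 := by
    rw [Nat.count_succ, if_pos hn]
  rw [valueEstimate, card_playTimes, hc, playTimes,
    sum_filter_range_count (fun n => A n ω = a) (fun m _ => r m ω), hc]
  simp [playReward]

theorem sau_eq {K : ℕ} {Ω : Type*} (A : ℕ → Ω → Fin K) (N : Ω → ℕ) (r : ℕ → Ω → ℝ)
    (a : Fin K) (ω : Ω) :
    sau A N r a ω =
      residualSum (playTimes A (N ω) a ω).card (fun j => playReward A r a j ω) /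
        ((playTimes A (N ω) a ω).card : ℝ) := by
  rw [sau, residualSum]
  congr 1
  rw [card_playTimes, playTimes]
  refine Eq.trans ?_ (sum_filter_range_count (fun n => A n ω = a) (fun m c =>
    (r m ω - (∑ j ∈ Finset.range (c + 1), playReward A r a j ω) / ((c : ℝ) + 1)) ^ 2) (N ω))
  refine Finset.sum_congr rfl fun n hn => ?_
  rw [valueEstimate_eq A r a (Finset.mem_filter.1 hn).2]

/-! ### The residual sum as a quadratic form. -/

theorem residualSum_sub_const (n : ℕ) (x : ℕ → ℝ) (m : ℝ) :
    residualSum n (fun j => x j - m) = residualSum n x := by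
  unfold residualSum
  refine Finset.sum_congr rfl fun k _ => ?_
  have : (k : ℝ) + 1 ≠ 0 := by positivity
  simp only [Finset.sum_sub_distrib, Finset.sum_const, Finset.card_range, nsmul_eq_mul]
  push_cast
  congr 1
  field_simp
  ring

/-- The tail `∑ 1 / (k + 1) ^ 2` over `i ≤ k < n`. -/
noncomputable def invSqTail (n i : ℕ) : ℝ := ∑ k ∈ Finset.Ico i n, 1 / ((k : ℝ) + 1) ^ 2

theorem invSqTail_succ {n i : ℕ} (h : i < n) :
    invSqTail n i = 1 / ((i : ℝ) + 1) ^ 2 + invSqTail n (i + 1) := by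
  rw [invSqTail, Finset.sum_eq_sum_Ico_succ_bot h, invSqTail]

theorem invSqTail_nonneg (n i : ℕ) : 0 ≤ invSqTail n i :=
  Finset.sum_nonneg fun _ _ => by positivity

/-- Telescoping, from 1/(k+1)² ≤ 1/k − 1/(k+1). -/
theorem invSqTail_succ_le {n i : ℕ} (h : i + 1 ≤ n) :
    invSqTail n (i + 1) ≤ 1 / ((i : ℝ) + 1) - 1 / n := by
  induction n, h using Nat.le_induction with
  | base => simp [invSqTail]
  | succ n hn ih =>
    have hn0 : (0 : ℝ) < n := by exact_mod_cast (by omega : 0 < n)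
    have h1 : 1 / ((n : ℝ) + 1) ^ 2 ≤ 1 / n - 1 / ((n : ℝ) + 1) := by
      rw [div_sub_div _ _ hn0.ne' (by positivity), div_le_div_iff₀ (by positivity) (by positivity)]
      nlinarith
    rw [invSqTail, Finset.sum_Ico_succ_top hn]
    rw [invSqTail] at ih
    push_cast
    linarith

/-- The coefficient of the square `y i ^ 2` in the residual sum. -/
noncomputable def sqCoeff (n i : ℕ) : ℝ := (i : ℝ) ^ 2 / ((i : ℝ) + 1) ^ 2 + invSqTail n (i + 1)

/-- The coefficient of the product of `y i` with the preceding partial sum in the residual sum. -/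
noncomputable def crossCoeff (n i : ℕ) : ℝ :=
  2 * invSqTail n (i + 1) - 2 * (i : ℝ) / ((i : ℝ) + 1) ^ 2

/-- The k-th residual is (k y_k − S_k)/(k+1). Its S_k² part unfolds through S_{i+1}² = S_i² + y_i² +
2 y_i S_i, so the pair (y_i², 2 y_i S_i) collects the weights 1/(k+1)² of all k > i. -/
theorem residualSum_eq (n : ℕ) (y : ℕ → ℝ) :
    residualSum n y = ∑ i ∈ Finset.range n,
      (sqCoeff n i * y i ^ 2 + crossCoeff n i * (y i * ∑ j ∈ Finset.range i, y j)) := by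
  -- The extra term is the contribution of the first m values to the later residuals through S_m²;
  -- it vanishes at m = n.
  suffices h : ∀ m ≤ n, residualSum m y + (∑ j ∈ Finset.range m, y j) ^ 2 * invSqTail n m =
      ∑ i ∈ Finset.range m,
        (sqCoeff n i * y i ^ 2 + crossCoeff n i * (y i * ∑ j ∈ Finset.range i, y j)) by
    simpa [invSqTail] using h n le_rfl
  intro m
  induction m with
  | zero => simp [residualSum]
  | succ m ih =>
    intro hm
    have h := ih (by omega)
    rw [Finset.sum_range_succ (fun i => sqCoeff n i * y i ^ 2 + _), ← h, residualSum, residualSum,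
      Finset.sum_range_succ, Finset.sum_range_succ y, invSqTail_succ hm, sqCoeff, crossCoeff]
    have : (m : ℝ) + 1 ≠ 0 := by positivity
    field_simp
    ring

theorem abs_sqCoeff_le {n i : ℕ} (h : i < n) : |sqCoeff n i| ≤ 1 := by
  have h1 := invSqTail_succ_le (Nat.succ_le_of_lt h)
  have h2 := invSqTail_nonneg n (i + 1)
  have h3 : (0 : ℝ) ≤ 1 / n := by positivity
  have h4 : (i : ℝ) ^ 2 / ((i : ℝ) + 1) ^ 2 + 1 / ((i : ℝ) + 1) ≤ 1 := by
    rw [div_add_div _ _ (by positivity) (by positivity), div_le_one (by positivity)]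
    nlinarith [(Nat.cast_nonneg i : (0 : ℝ) ≤ i), sq_nonneg ((i : ℝ) + 1)]
  rw [sqCoeff, abs_of_nonneg (by positivity)]
  linarith

theorem abs_crossCoeff_mul_le {n i : ℕ} (h : i < n) : |crossCoeff n i| * i ≤ 2 := by
  have h1 := invSqTail_succ_le (Nat.succ_le_of_lt h)
  have h2 := invSqTail_nonneg n (i + 1)
  have h3 : (0 : ℝ) ≤ 1 / n := by positivity
  have hi : (0 : ℝ) ≤ i := Nat.cast_nonneg i
  have h4 : 2 * (i : ℝ) / ((i : ℝ) + 1) ^ 2 * i ≤ 2 := by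
    rw [div_mul_eq_mul_div, div_le_iff₀ (by positivity)]
    nlinarith
  have h5 : 1 / ((i : ℝ) + 1) * i ≤ 1 := by
    rw [div_mul_eq_mul_div, div_le_one (by positivity)]
    linarith
  have h6 : invSqTail n (i + 1) * i ≤ 1 :=
    (mul_le_mul_of_nonneg_right (by linarith) hi).trans h5
  have h7 : 0 ≤ 2 * (i : ℝ) / ((i : ℝ) + 1) ^ 2 * i := by positivity
  have h8 : 0 ≤ invSqTail n (i + 1) * i := by positivity
  rw [← abs_of_nonneg hi, ← abs_mul, crossCoeff, abs_le]
  constructor <;> nlinarith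


/-! ### Functions of the past and independence. -/

section
variable {Ω : Type*} [MeasurableSpace Ω] {P : Measure Ω} {β : Type*} [MeasurableSpace β]
  {X : ℕ → Ω → ℝ} {F : (ℕ → ℝ) → β} {k : ℕ}

theorem aemeasurable_of_prefix (hX : ∀ j < k, AEMeasurable (X j) P) (hF : Measurable F)
    (hdep : ∀ x y : ℕ → ℝ, (∀ j < k, x j = y j) → F x = F y) :
    AEMeasurable (fun ω => F fun j => X j ω) P := by
  -- Nothing is known about `X j` for `j ≥ k`, so those coordinates are zeroed.
  have h : (fun ω => F fun j => X j ω) = fun ω => F fun j => if j < k then X j ω else 0 := by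
    funext ω
    exact hdep _ _ fun j hj => by simp [hj]
  rw [h]
  refine hF.comp_aemeasurable (aemeasurable_pi_lambda _ fun j => ?_)
  by_cases hj : j < k
  · simpa [hj] using hX j hj
  · simp [hj]

theorem indepFun_prefix {n : ℕ} (hind : iIndepFun (fun j : Fin n => X j) P)
    (hX : ∀ j < n, AEMeasurable (X j) P) (hk : k < n) (hF : Measurable F)
    (hdep : ∀ x y : ℕ → ℝ, (∀ j < k, x j = y j) → F x = F y) :
    IndepFun (fun ω => F fun j => X j ω) (X k) P := by
  classical
  let S : Finset (Fin n) := Finset.univ.filter fun j => (j : ℕ) < k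
  let T : Finset (Fin n) := {⟨k, hk⟩}
  have hST : Disjoint S T := by simp [S, T]
  have h := hind.indepFun_finset₀ S T hST fun j => hX j j.2
  let φ : (S → ℝ) → ℕ → ℝ := fun z j =>
    if hj : j < k then z ⟨⟨j, hj.trans hk⟩, by simpa [S] using hj⟩ else 0
  have hφ : Measurable φ := by
    refine measurable_pi_lambda _ fun j => ?_
    by_cases hj : j < k
    · simpa [φ, hj] using measurable_pi_apply _
    · simp [φ, hj]
  have h' := h.comp (hF.comp hφ) (measurable_pi_apply (⟨⟨k, hk⟩, by simp [T]⟩ : T))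
  refine h'.congr (ae_of_all _ fun ω => ?_) (ae_of_all _ fun ω => rfl)
  exact hdep _ _ fun j hj => by simp [φ, hj]

end

/-! ### The centred form and its exponential moments. -/

/-- The centred quadratic form with coefficients `a` on squares and `b` on the products of a term
with the preceding partial sum. -/
noncomputable def quadForm (a b : ℕ → ℝ) (s : ℝ) (k : ℕ) (y : ℕ → ℝ) : ℝ :=
  ∑ i ∈ Finset.range k, (a i * (y i ^ 2 - s) + b i * (y i * ∑ j ∈ Finset.range i, y j))

theorem measurable_quadForm (a b : ℕ → ℝ) (s : ℝ) (k : ℕ) : Measurable (quadForm a b s k) := by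
  unfold quadForm
  fun_prop

theorem sum_range_congr_prefix {k : ℕ} {x y : ℕ → ℝ} (h : ∀ j < k, x j = y j) :
    ∑ j ∈ Finset.range k, x j = ∑ j ∈ Finset.range k, y j :=
  Finset.sum_congr rfl fun j hj => h j (Finset.mem_range.1 hj)

theorem quadForm_congr (a b : ℕ → ℝ) (s : ℝ) {k : ℕ} {x y : ℕ → ℝ} (h : ∀ j < k, x j = y j) :
    quadForm a b s k x = quadForm a b s k y := by
  refine Finset.sum_congr rfl fun i hi => ?_
  have hi := Finset.mem_range.1 hi
  rw [h i hi, sum_range_congr_prefix fun j hj => h j (hj.trans hi)]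

theorem ae_abs_le_one {Ω : Type*} [MeasurableSpace Ω] {P : Measure Ω} {ρ : Measure ℝ}
    {X : ℕ → Ω → ℝ} {n : ℕ} (hb : ∀ᵐ y ∂ρ, |y| ≤ 1)
    (hX : ∀ j < n, HasLaw (X j) ρ P) :
    ∀ᵐ ω ∂P, ∀ j < n, |X j ω| ≤ 1 := by
  rw [ae_all_iff]
  intro j
  by_cases hj : j < n
  · have hm : Measurable fun y : ℝ => |y| ≤ 1 :=
      measurableSet_setOfPred.1 (measurableSet_le (by fun_prop) measurable_const)
    filter_upwards [((hX j hj).ae_iff hm).2 hb] with ω h _ using h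
  · exact ae_of_all _ fun ω h => absurd h hj

theorem abs_sum_range_le {k : ℕ} {y : ℕ → ℝ} (h : ∀ j < k, |y j| ≤ 1) :
    |∑ j ∈ Finset.range k, y j| ≤ k := by
  refine (Finset.abs_sum_le_sum_abs _ _).trans ?_
  refine (Finset.sum_le_card_nsmul _ _ 1 fun j hj => h j (Finset.mem_range.1 hj)).trans ?_
  simp

section
variable {ρ : Measure ℝ} [IsProbabilityMeasure ρ] {s : ℝ}

theorem integrable_of_continuous_of_abs_le_one (hb : ∀ᵐ y ∂ρ, |y| ≤ 1) {f : ℝ → ℝ}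
    (hf : Continuous f) : Integrable f ρ := by
  obtain ⟨C, hC⟩ := (isCompact_Icc (a := (-1 : ℝ)) (b := 1)).exists_bound_of_continuousOn
    hf.continuousOn
  refine Integrable.of_bound hf.aestronglyMeasurable C ?_
  filter_upwards [hb] with y hy
  exact hC y (abs_le.1 hy)

theorem sq_integral_mem (hb : ∀ᵐ y ∂ρ, |y| ≤ 1) (hs : ∫ y, y ^ 2 ∂ρ = s) : 0 ≤ s ∧ s ≤ 1 := by
  have hi := integrable_of_continuous_of_abs_le_one hb (f := fun y => y ^ 2) (by fun_prop)
  refine ⟨hs ▸ integral_nonneg fun y => sq_nonneg y, ?_⟩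
  rw [← hs]
  have := integral_mono_ae hi (integrable_const (1 : ℝ))
    (by filter_upwards [hb] with y hy using (sq_le_one_iff_abs_le_one y).2 hy)
  simpa using this

/-- Second-order bounds suffice: e^x ≤ 1 + x + x², (p + q)² ≤ 2p² + 2q² and y⁴ ≤ y² leave a
quadratic polynomial in y, whose mean retains the variance factor `s`. -/
theorem integral_exp_le (hb : ∀ᵐ y ∂ρ, |y| ≤ 1) (h0 : ∫ y, y ∂ρ = 0) (hs : ∫ y, y ^ 2 ∂ρ = s)
    {u v : ℝ} (huv : |u| + |v| ≤ 1) :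
    ∫ y, Real.exp (u * (y ^ 2 - s) + v * y) ∂ρ ≤ Real.exp (2 * (u ^ 2 + v ^ 2) * s) := by
  obtain ⟨hs0, hs1⟩ := sq_integral_mem hb hs
  have hI : ∀ f : ℝ → ℝ, Continuous f → Integrable f ρ :=
    fun f hf => integrable_of_continuous_of_abs_le_one hb hf
  have hpt : ∀ᵐ y ∂ρ, Real.exp (u * (y ^ 2 - s) + v * y) ≤
      (1 - u * s + 2 * u ^ 2 * s ^ 2) + v * y +
        (u + 2 * u ^ 2 * (1 - 2 * s) + 2 * v ^ 2) * y ^ 2 := by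
    filter_upwards [hb] with y hy
    have hy2 := (sq_le_one_iff_abs_le_one y).2 hy
    have hy0 := sq_nonneg y
    have h1 : |y ^ 2 - s| ≤ 1 := abs_le.2 ⟨by linarith, by linarith⟩
    have h2 : |u * (y ^ 2 - s) + v * y| ≤ 1 := by
      refine (abs_add_le _ _).trans ?_
      rw [abs_mul, abs_mul]
      nlinarith [abs_nonneg u, abs_nonneg v, abs_nonneg y]
    refine (exp_le_one_add_add_sq h2).trans ?_
    nlinarith [sq_nonneg (u * (y ^ 2 - s) - v * y),
      mul_nonneg (sq_nonneg u) (mul_nonneg hy0 (sub_nonneg.2 hy2))]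
  refine (integral_mono_ae (hI _ (by fun_prop)) (hI _ (by fun_prop)) hpt).trans ?_
  rw [integral_add (hI _ (by fun_prop)) (hI _ (by fun_prop)),
    integral_add (hI _ (by fun_prop)) (hI _ (by fun_prop)), integral_const_mul,
    integral_const_mul, h0, hs]
  simp only [integral_const, probReal_univ, smul_eq_mul]
  have := Real.add_one_le_exp (2 * (u ^ 2 + v ^ 2) * s)
  nlinarith [mul_nonneg (sq_nonneg u) (sq_nonneg s)]

theorem lintegral_exp_le (hb : ∀ᵐ y ∂ρ, |y| ≤ 1) (h0 : ∫ y, y ∂ρ = 0) (hs : ∫ y, y ^ 2 ∂ρ = s)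
    {u v : ℝ} (huv : |u| + |v| ≤ 1) :
    ∫⁻ y, ENNReal.ofReal (Real.exp (u * (y ^ 2 - s) + v * y)) ∂ρ ≤
      ENNReal.ofReal (Real.exp (2 * (u ^ 2 + v ^ 2) * s)) := by
  rw [← ofReal_integral_eq_lintegral_ofReal
    (integrable_of_continuous_of_abs_le_one hb (by fun_prop))
    (ae_of_all _ fun y => (Real.exp_pos _).le)]
  exact ENNReal.ofReal_le_ofReal (integral_exp_le hb h0 hs huv)

variable {Ω : Type*} [MeasurableSpace Ω] {P : Measure Ω} [IsProbabilityMeasure P]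
  {X : ℕ → Ω → ℝ} {n : ℕ} {a b : ℕ → ℝ}

theorem lintegral_exp_quadForm_le (hb : ∀ᵐ y ∂ρ, |y| ≤ 1) (h0 : ∫ y, y ∂ρ = 0)
    (hs : ∫ y, y ^ 2 ∂ρ = s) (hind : iIndepFun (fun j : Fin n => X j) P)
    (hX : ∀ j < n, HasLaw (X j) ρ P) (ha : ∀ i < n, |a i| ≤ 1) (hbc : ∀ i < n, |b i| * i ≤ 2)
    {θ : ℝ} (hθ : |θ| ≤ 1 / 3) {k : ℕ} (hk : k ≤ n) :
    ∫⁻ ω, ENNReal.ofReal (Real.exp (θ * quadForm a b s k fun j => X j ω)) ∂P ≤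
      ENNReal.ofReal (Real.exp (10 * θ ^ 2 * s * k)) := by
  obtain ⟨hs0, hs1⟩ := sq_integral_mem hb hs
  induction k with
  | zero => simp [quadForm]
  | succ k ih =>
    have hkn : k < n := hk
    have hXm : ∀ j < n, AEMeasurable (X j) P := fun j hj => (hX j hj).aemeasurable
    -- The past enters the next increment only through this pair, so Fubini integrates out `X k`
    -- with the pair frozen.
    let F : (ℕ → ℝ) → ℝ × ℝ := fun y => (quadForm a b s k y, ∑ j ∈ Finset.range k, y j)
    have hF : Measurable F := (measurable_quadForm a b s k).prodMk (by fun_prop)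
    have hdep : ∀ x y : ℕ → ℝ, (∀ j < k, x j = y j) → F x = F y := fun x y h =>
      Prod.ext (quadForm_congr a b s h) (sum_range_congr_prefix h)
    have hFm := aemeasurable_of_prefix (P := P) (fun j hj => hXm j (hj.trans hkn)) hF hdep
    have hmap := (indepFun_iff_map_prod_eq_prod_map_map hFm (hXm k hkn)).1
      (indepFun_prefix hind hXm hkn hF hdep)
    rw [(hX k hkn).map_eq] at hmap
    let G : (ℝ × ℝ) × ℝ → ENNReal := fun z =>
      ENNReal.ofReal (Real.exp (θ * z.1.1)) *
        ENNReal.ofReal (Real.exp (θ * a k * (z.2 ^ 2 - s) + θ * b k * z.1.2 * z.2))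
    have hG : Measurable G := by fun_prop
    have hL : ∫⁻ ω, ENNReal.ofReal (Real.exp (θ * quadForm a b s (k + 1) fun j => X j ω)) ∂P =
        ∫⁻ z, G z ∂((P.map fun ω => F fun j => X j ω).prod ρ) := by
      rw [← hmap, lintegral_map' hG.aemeasurable (hFm.prodMk (hXm k hkn))]
      refine lintegral_congr fun ω => ?_
      simp only [G, F]
      rw [← ENNReal.ofReal_mul (Real.exp_pos _).le, ← Real.exp_add, quadForm,
        Finset.sum_range_succ, ← quadForm]
      congr 2
      ring
    rw [hL, lintegral_prod _ hG.aemeasurable, lintegral_map' _ hFm]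
    swap
    · exact hG.lintegral_prod_right'.aemeasurable
    have hbd : ∀ᵐ ω ∂P, ∫⁻ y, G (F fun j => X j ω, y) ∂ρ ≤
        ENNReal.ofReal (Real.exp (θ * quadForm a b s k fun j => X j ω)) *
          ENNReal.ofReal (Real.exp (10 * θ ^ 2 * s)) := by
      filter_upwards [ae_abs_le_one hb hX] with ω hω
      simp only [G]
      rw [lintegral_const_mul _ (by fun_prop)]
      refine mul_le_mul_right ?_ _
      have hT := abs_sum_range_le fun j (hj : j < k) => hω j (hj.trans hkn)
      set T := ∑ j ∈ Finset.range k, X j ω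
      have hbT : |b k * T| ≤ 2 := by
        rw [abs_mul]
        exact (mul_le_mul_of_nonneg_left hT (abs_nonneg _)).trans (hbc k hkn)
      -- Here |θ| (1 + 2) ≤ 1 forces the range 1/3; below, 2 (1² + 2²) produces the 10.
      have h1 : |θ * a k| + |θ * b k * T| ≤ 1 := by
        rw [mul_assoc, abs_mul, abs_mul θ]
        nlinarith [abs_nonneg θ, ha k hkn, abs_nonneg (a k), abs_nonneg (b k * T)]
      refine (lintegral_exp_le hb h0 hs h1).trans (ENNReal.ofReal_le_ofReal (Real.exp_le_exp.2 ?_))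
      refine mul_le_mul_of_nonneg_right ?_ hs0
      have h2 : (a k) ^ 2 ≤ 1 := (sq_le_one_iff_abs_le_one _).2 (ha k hkn)
      have h3 : (b k * T) ^ 2 ≤ 4 := by
        rw [← sq_abs]
        nlinarith [abs_nonneg (b k * T)]
      nlinarith [mul_le_mul_of_nonneg_left h2 (sq_nonneg θ),
        mul_le_mul_of_nonneg_left h3 (sq_nonneg θ)]
    refine (lintegral_mono_ae hbd).trans ?_
    rw [lintegral_mul_const' _ _ ENNReal.ofReal_ne_top]
    refine (mul_le_mul_left (ih (by omega)) _).trans ?_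
    rw [← ENNReal.ofReal_mul (Real.exp_pos _).le, ← Real.exp_add]
    refine ENNReal.ofReal_le_ofReal (Real.exp_le_exp.2 (le_of_eq ?_))
    push_cast
    ring

end


/-! ### Tail bound and mean of the form. -/

theorem aemeasurable_quadForm {Ω : Type*} [MeasurableSpace Ω] {P : Measure Ω} {ρ : Measure ℝ}
    {X : ℕ → Ω → ℝ} {n : ℕ} (a b : ℕ → ℝ) (s : ℝ) (hX : ∀ j < n, HasLaw (X j) ρ P) :
    AEMeasurable (fun ω => quadForm a b s n fun j => X j ω) P :=
  aemeasurable_of_prefix (fun j hj => (hX j hj).aemeasurable) (measurable_quadForm a b s n)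
    fun _ _ h => quadForm_congr a b s h

section
variable {ρ : Measure ℝ} {s : ℝ}
  {Ω : Type*} [MeasurableSpace Ω] {P : Measure Ω} [IsProbabilityMeasure P]
  {X : ℕ → Ω → ℝ} {n : ℕ} {a b : ℕ → ℝ}

theorem measureReal_le_quadForm_le [IsProbabilityMeasure ρ] (hb : ∀ᵐ y ∂ρ, |y| ≤ 1)
    (h0 : ∫ y, y ∂ρ = 0)
    (hs : ∫ y, y ^ 2 ∂ρ = s) (hind : iIndepFun (fun j : Fin n => X j) P)
    (hX : ∀ j < n, HasLaw (X j) ρ P) (ha : ∀ i < n, |a i| ≤ 1) (hbc : ∀ i < n, |b i| * i ≤ 2)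
    {θ : ℝ} (hθ0 : 0 ≤ θ) (hθ : θ ≤ 1 / 3) (ε : ℝ) :
    P.real {ω | ε ≤ |quadForm a b s n fun j => X j ω|} ≤
      2 * Real.exp (10 * θ ^ 2 * s * n - θ * ε) := by
  -- `η` is the sign: each tail is one Chernoff bound.
  have hone : ∀ η : ℝ, |η| = 1 → P.real {ω | ε ≤ η * quadForm a b s n fun j => X j ω} ≤
      Real.exp (10 * θ ^ 2 * s * n - θ * ε) := by
    intro η hη
    have hle := lintegral_exp_quadForm_le hb h0 hs hind hX ha hbc (θ := θ * η)
      (by rwa [abs_mul, hη, mul_one, abs_of_nonneg hθ0]) le_rfl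
    rw [mul_pow, ← sq_abs η, hη] at hle
    simp only [mul_assoc θ η, one_pow, mul_one] at hle
    have hm : AEStronglyMeasurable
        (fun ω => Real.exp (θ * (η * quadForm a b s n fun j => X j ω))) P :=
      (Real.measurable_exp.comp_aemeasurable
        (((aemeasurable_quadForm a b s hX).const_mul η).const_mul θ)).aestronglyMeasurable
    have hint : Integrable (fun ω => Real.exp (θ * (η * quadForm a b s n fun j => X j ω))) P := by
      refine ⟨hm, ?_⟩
      rw [hasFiniteIntegral_iff_ofReal (ae_of_all _ fun ω => (Real.exp_pos _).le)]
      exact hle.trans_lt ENNReal.ofReal_lt_top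
    refine (measure_ge_le_exp_mul_mgf ε hθ0 hint).trans ?_
    have hmgf : mgf (fun ω => η * quadForm a b s n fun j => X j ω) P θ ≤
        Real.exp (10 * θ ^ 2 * s * n) := by
      rw [mgf, integral_eq_lintegral_of_nonneg_ae (ae_of_all _ fun ω => (Real.exp_pos _).le) hm]
      exact ENNReal.toReal_le_of_le_ofReal (Real.exp_pos _).le hle
    refine (mul_le_mul_of_nonneg_left hmgf (Real.exp_pos _).le).trans (le_of_eq ?_)
    rw [← Real.exp_add]
    congr 1
    ring
  have hsub : {ω | ε ≤ |quadForm a b s n fun j => X j ω|} ⊆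
      {ω | ε ≤ 1 * quadForm a b s n fun j => X j ω} ∪
        {ω | ε ≤ -1 * quadForm a b s n fun j => X j ω} := by
    intro ω hω
    simpa [le_abs] using hω
  refine (measureReal_mono hsub).trans ((measureReal_union_le _ _).trans ?_)
  linarith [hone 1 (by simp), hone (-1) (by simp)]

theorem integrable_and_integral_quadForm (hb : ∀ᵐ y ∂ρ, |y| ≤ 1) (h0 : ∫ y, y ∂ρ = 0)
    (hs : ∫ y, y ^ 2 ∂ρ = s) (hind : iIndepFun (fun j : Fin n => X j) P)
    (hX : ∀ j < n, HasLaw (X j) ρ P) :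
    Integrable (fun ω => quadForm a b s n fun j => X j ω) P ∧
      ∫ ω, quadForm a b s n (fun j => X j ω) ∂P = 0 := by
  have hbd := ae_abs_le_one hb hX
  have hsq : ∀ i < n, Integrable (fun ω => X i ω ^ 2) P := by
    intro i hi
    refine Integrable.of_bound ((hX i hi).aemeasurable.pow_const 2).aestronglyMeasurable 1 ?_
    filter_upwards [hbd] with ω hω
    rw [Real.norm_eq_abs, abs_pow]
    exact pow_le_one₀ (abs_nonneg _) (hω i hi)
  have hsum : ∀ i ≤ n, AEMeasurable (fun ω => ∑ j ∈ Finset.range i, X j ω) P := fun i hi =>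
    aemeasurable_of_prefix (F := fun y : ℕ → ℝ => ∑ j ∈ Finset.range i, y j)
      (fun j hj => (hX j (hj.trans_le hi)).aemeasurable) (by fun_prop)
      fun _ _ h => sum_range_congr_prefix h
  have hcr : ∀ i < n, Integrable (fun ω => X i ω * ∑ j ∈ Finset.range i, X j ω) P := by
    intro i hi
    refine Integrable.of_bound
      ((hX i hi).aemeasurable.mul (hsum i hi.le)).aestronglyMeasurable i ?_
    filter_upwards [hbd] with ω hω
    rw [Real.norm_eq_abs, abs_mul]
    have h1 := abs_sum_range_le fun j (hj : j < i) => hω j (hj.trans hi)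
    nlinarith [hω i hi, abs_nonneg (X i ω), abs_nonneg (∑ j ∈ Finset.range i, X j ω)]
  have hint : ∀ i ∈ Finset.range n, Integrable (fun ω => a i * (X i ω ^ 2 - s) +
      b i * (X i ω * ∑ j ∈ Finset.range i, X j ω)) P := by
    intro i hi
    have hi := Finset.mem_range.1 hi
    exact (((hsq i hi).sub (integrable_const s)).const_mul _).add ((hcr i hi).const_mul _)
  refine ⟨integrable_finsetSum _ hint, ?_⟩
  simp only [quadForm]
  rw [integral_finsetSum _ hint]
  refine Finset.sum_eq_zero fun i hi => ?_
  have hi := Finset.mem_range.1 hi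
  have h1 : ∫ ω, X i ω ^ 2 ∂P = s := by
    rw [← hs]
    exact (hX i hi).integral_comp (f := fun y : ℝ => y ^ 2) (by fun_prop)
  have h2 : ∫ ω, X i ω * ∑ j ∈ Finset.range i, X j ω ∂P = 0 := by
    have hI := (indepFun_prefix (F := fun y : ℕ → ℝ => ∑ j ∈ Finset.range i, y j) hind
      (fun j hj => (hX j hj).aemeasurable) hi (by fun_prop)
      fun _ _ h => sum_range_congr_prefix h).symm
    rw [hI.integral_fun_mul_eq_mul_integral (hX i hi).aemeasurable.aestronglyMeasurable
      (hsum i hi.le).aestronglyMeasurable, (hX i hi).integral_eq, h0, zero_mul]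
  have h3 : Integrable (fun ω => a i * (X i ω ^ 2 - s)) P :=
    ((hsq i hi).sub (integrable_const s)).const_mul _
  rw [integral_add h3 ((hcr i hi).const_mul _),
    integral_const_mul, integral_const_mul, h2, integral_sub (hsq i hi) (integrable_const s), h1]
  simp

end

/-! ### Choice of parameters and conclusion. -/

theorem residualSum_eq_quadForm (n : ℕ) (s : ℝ) (y : ℕ → ℝ) :
    residualSum n y = quadForm (sqCoeff n) (crossCoeff n) s n y +
      s * ∑ i ∈ Finset.range n, sqCoeff n i := by
  rw [residualSum_eq, quadForm, Finset.mul_sum, ← Finset.sum_add_distrib]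
  exact Finset.sum_congr rfl fun i _ => by ring

theorem chernoff_exponent {n : ℕ} {σ δ : ℝ} (hn : 0 < n) (hσ : 0 < σ)
    (hδ0 : 2 * Real.exp (-(σ ^ 2 * n / (32 * 5))) ≤ δ) (hδ : 0 < δ) (hδ1 : δ < 1) :
    ∃ θ, 0 ≤ θ ∧ θ ≤ 1 / 3 ∧
      2 * Real.exp (10 * θ ^ 2 * σ ^ 2 * n -
        θ * (n * (σ * Real.sqrt (8 * 5 * Real.log (2 / δ) / n)))) = δ := by
  have hn' : (0 : ℝ) < n := by exact_mod_cast hn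
  have hL0 : 0 < Real.log (2 / δ) := Real.log_pos (by rw [lt_div_iff₀ hδ]; linarith)
  have hL : Real.log (2 / δ) ≤ σ ^ 2 * n / (32 * 5) := by
    rw [Real.log_le_iff_le_exp (by positivity), div_le_iff₀ hδ]
    have := mul_le_mul_of_nonneg_left hδ0 (Real.exp_pos (σ ^ 2 * n / (32 * 5))).le
    rwa [mul_left_comm, ← Real.exp_add, add_neg_cancel, Real.exp_zero, mul_one] at this
  set q := Real.sqrt (8 * 5 * Real.log (2 / δ) / n) with hq
  have hq0 : 0 ≤ q := Real.sqrt_nonneg _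
  have hq2 : q ^ 2 * n = 40 * Real.log (2 / δ) := by
    rw [hq, Real.sq_sqrt (by positivity)]
    field_simp
    norm_num
  have hqσ : q ≤ σ / 2 := by
    refine abs_le_of_sq_le_sq' ?_ (by positivity) |>.2
    refine le_of_mul_le_mul_right ?_ hn'
    rw [hq2]
    linarith
  -- The minimiser of the exponent, with minimum −q²n/40; `q ≤ σ / 2` makes it at most 1/40.
  refine ⟨q / (20 * σ), by positivity, ?_, ?_⟩
  · rw [div_le_iff₀ (by positivity)]
    linarith
  · have : 10 * (q / (20 * σ)) ^ 2 * σ ^ 2 * n - q / (20 * σ) * (n * (σ * q)) =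
        -Real.log (2 / δ) := by
      have h1 : 10 * (q / (20 * σ)) ^ 2 * σ ^ 2 * n - q / (20 * σ) * (n * (σ * q)) =
          -(q ^ 2 * n) / 40 := by
        field_simp
        ring
      rw [h1, hq2]
      ring
    rw [this, Real.exp_neg, Real.exp_log (by positivity)]
    field_simp

theorem ae_abs_sub_integral_le_one {ν : Measure ℝ} [IsProbabilityMeasure ν]
    (hν : ∀ᵐ x ∂ν, x ∈ Set.Icc (0 : ℝ) 1) : ∀ᵐ x ∂ν, |x - ∫ y, y ∂ν| ≤ 1 := by
  have hi : Integrable (fun y : ℝ => y) ν := Integrable.of_mem_Icc 0 1 aemeasurable_id hν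
  have h0 : 0 ≤ ∫ y, y ∂ν := integral_nonneg_of_ae (by filter_upwards [hν] with x hx using hx.1)
  have h1 : ∫ y, y ∂ν ≤ 1 := by
    simpa using integral_mono_ae hi (integrable_const (1 : ℝ))
      (by filter_upwards [hν] with x hx using hx.2)
  filter_upwards [hν] with x hx
  exact abs_le.2 ⟨by linarith [hx.1], by linarith [hx.2]⟩

end Bandit

theorem mainTheorem3 :
    ∃ c : ℝ, 0 < c ∧
      ∀ {Ω : Type*} [MeasurableSpace Ω] (P : Measure Ω) [IsProbabilityMeasure P]
        (K : ℕ) (a : Fin K) (A : ℕ → Ω → Fin K) (r : ℕ → Ω → ℝ) (N : Ω → ℕ) (nₐ : ℕ)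
        (ν : Measure ℝ) [IsProbabilityMeasure ν],
        (∀ᵐ x ∂ν, x ∈ Set.Icc (0 : ℝ) 1) →
        (∀ᵐ ω ∂P, (Bandit.playTimes A (N ω) a ω).card = nₐ) →
        iIndepFun (fun (j : Fin nₐ) (ω : Ω) => Bandit.playReward A r a j ω) P →
        (∀ j : Fin nₐ, HasLaw (fun ω => Bandit.playReward A r a j ω) ν P) →
        ∀ σ : ℝ, 0 ≤ σ → σ ^ 2 = variance id ν →
          Integrable (Bandit.sau A N r a) P ∧
          ∀ δ : ℝ, 2 * Real.exp (-(σ ^ 2 * nₐ / (32 * c))) ≤ δ → δ < 1 →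
            P.real {ω | σ * Real.sqrt (8 * c * Real.log (2 / δ) / nₐ) ≤
                |Bandit.sau A N r a ω - ∫ ω', Bandit.sau A N r a ω' ∂P|} ≤ δ := by
  -- With c = 5, 8c = 40 cancels the 40 in the Chernoff minimum.
  refine ⟨5, by norm_num, ?_⟩
  intro Ω _ P _ K a A r N n ν _ hν hcard hind hlaw σ hσ hσv
  set m := ∫ y, y ∂ν with hm
  have hms : Measurable fun y : ℝ => y - m := by fun_prop
  set ρ := ν.map fun y => y - m with hρ
  have : IsProbabilityMeasure ρ := Measure.isProbabilityMeasure_map hms.aemeasurable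
  have hi : Integrable (fun y : ℝ => y) ν := Integrable.of_mem_Icc 0 1 aemeasurable_id hν
  have hb : ∀ᵐ y ∂ρ, |y| ≤ 1 := by
    rw [hρ, ae_map_iff hms.aemeasurable (measurableSet_le (by fun_prop) measurable_const)]
    exact Bandit.ae_abs_sub_integral_le_one hν
  have h0 : ∫ y, y ∂ρ = 0 := by
    rw [hρ, integral_map hms.aemeasurable (by fun_prop), integral_sub hi (integrable_const m)]
    simp [hm]
  have hs : ∫ y, y ^ 2 ∂ρ = σ ^ 2 := by
    rw [hσv, variance_eq_integral aemeasurable_id, hρ,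
      integral_map hms.aemeasurable (by fun_prop)]
    rfl
  let X : ℕ → Ω → ℝ := fun j ω => Bandit.playReward A r a j ω - m
  have hX : ∀ j < n, HasLaw (X j) ρ P := fun j hj =>
    HasLaw.fun_comp ⟨hms.aemeasurable, rfl⟩ (hlaw ⟨j, hj⟩)
  have hindX : iIndepFun (fun j : Fin n => X j) P := hind.comp (fun _ y => y - m) fun _ => hms
  let Q : Ω → ℝ := fun ω => Bandit.quadForm (Bandit.sqCoeff n) (Bandit.crossCoeff n) (σ ^ 2) n
    fun j => X j ω
  obtain ⟨hQi, hQ0⟩ := Bandit.integrable_and_integral_quadForm (a := Bandit.sqCoeff n)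
    (b := Bandit.crossCoeff n) hb h0 hs hindX hX
  let C := σ ^ 2 * ∑ i ∈ Finset.range n, Bandit.sqCoeff n i
  have hsau : Bandit.sau A N r a =ᵐ[P] fun ω => (Q ω + C) / n := by
    filter_upwards [hcard] with ω hω
    rw [Bandit.sau_eq, hω, ← Bandit.residualSum_sub_const n _ m,
      Bandit.residualSum_eq_quadForm n (σ ^ 2)]
  have hsi : Integrable (fun ω => (Q ω + C) / n) P := (hQi.add (integrable_const C)).div_const _
  refine ⟨hsi.congr hsau.symm, fun δ hδ hδ1 => ?_⟩
  have hδ0 : 0 < δ := lt_of_lt_of_le (by positivity) hδ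
  -- Otherwise the lower bound on δ is 2, against δ < 1.
  have hpos : 0 < σ ^ 2 * n := by
    by_contra h
    have h' : σ ^ 2 * n = 0 := le_antisymm (not_lt.1 h) (by positivity)
    rw [h'] at hδ
    norm_num at hδ
    linarith
  have hn : 0 < n := by
    rcases Nat.eq_zero_or_pos n with h | h
    · simp [h] at hpos
    · exact h
  have hσ0 : 0 < σ := lt_of_le_of_ne hσ fun h => by simp [← h] at hpos
  have hn' : (0 : ℝ) < n := by exact_mod_cast hn
  have hE : ∫ ω, Bandit.sau A N r a ω ∂P = C / n := by
    rw [integral_congr_ae hsau, integral_div, integral_add hQi (integrable_const C), hQ0]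
    simp
  obtain ⟨θ, hθ0, hθ1, hθ⟩ := Bandit.chernoff_exponent hn hσ0 hδ hδ0 hδ1
  rw [hE]
  refine le_trans (le_of_eq (measureReal_congr ?_))
    ((Bandit.measureReal_le_quadForm_le hb h0 hs hindX hX (fun i hi => Bandit.abs_sqCoeff_le hi)
      (fun i hi => Bandit.abs_crossCoeff_mul_le hi) hθ0 hθ1 _).trans hθ.le)
  filter_upwards [hsau] with ω hω
  refine propext ?_
  change _ ≤ |Bandit.sau A N r a ω - C / n| ↔ _ ≤ |Q ω|
  rw [hω, ← sub_div, add_sub_cancel_right, abs_div, abs_of_pos hn', le_div_iff₀' hn']
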